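/- Let $A$ be a commutative ring, let $r,p,d,n\ge 0$ be integers, let $S=A[X_0,\dots,X_r]$ with its standard grading, and let $M=\bigoplus_{i=1}^p S$, graded by $M_t=\bigoplus_{i=1}^p S_t$. Let $N\subseteq M$ be a graded $S$-submodule that is generated by homogeneous elements of degree at most $d$, and let $Q=M/N$ with graded pieces $Q_t$. Suppose that 1. for every prime ideal $\mathfrak p\subset A$, with residue field $k(\mathfrak p)$, the fiber $Q\otimes_A k(\mathfrak p)$ has constant Hilbert polynomial $P(t)=n$, that is, $\dim_{k(\mathfrak p)}\bigl(Q_t\otimes_A k(\mathfrak p)\bigr)=n$ for all sufficiently large $t$ (depending on $\mathfrak p$); 2. the $A$-module $Q_d$ is locally free of rank $n$, and $n\le d$. Then $\operatorname{Fitt}_{n-1}(Q_{d+s})=\operatorname{Fitt}_{n-1}(Q_{d+1})$ as ideals of $A$ for all integers $s>0$. Here, for a finitely generated $A$-module $L$ with a free presentation $F\xrightarrow{\psi}A^m\to L\to 0$ and an integer $i$, the Fitting ideal $\operatorname{Fitt}_i(L)$ is the ideal of $A$ generated by the $(m-i)$-minors of the matrix of $\psi$ (the unit ideal if $m-i\le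 0$); it does not depend on the presentation, and $\operatorname{Fitt}_{-1}(L)=0$. -/

import Mathlib

open scoped TensorProduct

section GradedPieces

variable (A : Type*) [CommRing A] (r p : ℕ)

/-- The polynomial ring `S = A[X_0, …, X_r]`. -/
abbrev PolyRing : Type _ := MvPolynomial (Fin (r + 1)) A

/-- The free module `M = ⨁_{i=1}^p S`. -/
abbrev FreeMod : Type _ := Fin p → PolyRing A r

/-- The graded piece `M_t = ⨁_{i=1}^p S_t`, as an `A`-submodule of `M`. -/
noncomputable def freePiece (t : ℕ) : Submodule A (FreeMod A r p) :=
  Submodule.pi Set.univ fun _ => MvPolynomial.homogeneousSubmodule (Fin (r + 1)) A t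

/-- The projection of `M` onto its degree `t` part. -/
noncomputable def freeComponent (t : ℕ) : FreeMod A r p →ₗ[A] FreeMod A r p :=
  LinearMap.pi fun i => MvPolynomial.homogeneousComponent t ∘ₗ LinearMap.proj i

variable {A r p}

theorem mem_freePiece {t : ℕ} {x : FreeMod A r p} :
    x ∈ freePiece A r p t ↔ ∀ i, (x i).IsHomogeneous t := by
  simp [freePiece, Submodule.mem_pi]

theorem freeComponent_mem (t : ℕ) (x : FreeMod A r p) :
    freeComponent A r p t x ∈ freePiece A r p t :=
  mem_freePiece.2 fun i => MvPolynomial.homogeneousComponent_isHomogeneous t (x i)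

theorem freeComponent_of_mem {t u : ℕ} {x : FreeMod A r p} (hx : x ∈ freePiece A r p t) :
    freeComponent A r p u x = if u = t then x else 0 := by
  funext i
  have h : MvPolynomial.homogeneousComponent u (x i) = if u = t then x i else 0 :=
    MvPolynomial.homogeneousComponent_of_mem (mem_freePiece.1 hx i)
  have h' : freeComponent A r p u x i = MvPolynomial.homogeneousComponent u (x i) := rfl
  rw [h', h]
  split_ifs <;> rfl

theorem sum_freeComponent (x : FreeMod A r p) :
    ∑ t ∈ Finset.range (Finset.univ.sup (fun i => (x i).totalDegree) + 1),
      freeComponent A r p t x = x := by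
  funext i
  rw [Finset.sum_apply]
  conv_rhs => rw [← MvPolynomial.sum_homogeneousComponent (x i)]
  symm
  apply Finset.sum_subset
  · intro t ht
    have := Finset.le_sup (f := fun i => (x i).totalDegree) (Finset.mem_univ i)
    simp only [Finset.mem_range] at ht ⊢
    omega
  · intro t _ ht
    exact MvPolynomial.homogeneousComponent_eq_zero t (x i) (by simpa using ht)

theorem freePiece_isInternal : DirectSum.IsInternal (freePiece A r p) := by
  classical
  constructor
  · have key : ∀ (z : DirectSum ℕ fun t => freePiece A r p t) (t : ℕ),
        freeComponent A r p t (DirectSum.coeLinearMap (freePiece A r p) z) = z t := by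
      intro z t
      induction z using DirectSum.induction_on with
      | zero => simp
      | of u y =>
        rw [← DirectSum.lof_eq_of A, DirectSum.coeLinearMap_lof, freeComponent_of_mem y.2,
          DirectSum.lof_eq_of, DirectSum.coe_of_apply]
        simp only [eq_comm (a := t)]
        split_ifs <;> rfl
      | add a b ha hb => rw [map_add, map_add, ha, hb]; rfl
    intro a b hab
    refine DFinsupp.ext fun t => Subtype.ext ?_
    rw [← key a t, ← key b t]
    exact congrArg _ hab
  · intro x
    refine ⟨∑ t ∈ Finset.range (Finset.univ.sup (fun i => (x i).totalDegree) + 1),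
      DirectSum.of (fun t => freePiece A r p t) t ⟨_, freeComponent_mem t x⟩, ?_⟩
    rw [map_sum]
    simp only [DirectSum.coeAddMonoidHom_of]
    exact sum_freeComponent x

noncomputable instance freePiece_decomposition :
    DirectSum.Decomposition (freePiece A r p) :=
  freePiece_isInternal.chooseDecomposition

/-- `N` is generated, as an `S`-module, by its homogeneous elements of degree at most `d`. -/
def GeneratedInDegreesLE (N : Submodule (PolyRing A r) (FreeMod A r p)) (d : ℕ) : Prop :=
  N = Submodule.span (PolyRing A r) {x | x ∈ N ∧ ∃ t ≤ d, x ∈ freePiece A r p t}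

/-- The graded piece `Q_t` of the quotient `Q = M / N`: the image of `M_t` in `Q`, as an
`A`-submodule of `Q`. -/
noncomputable def quotPiece (N : Submodule (PolyRing A r) (FreeMod A r p)) (t : ℕ) :
    Submodule A (FreeMod A r p ⧸ N) :=
  (freePiece A r p t).map (N.mkQ.restrictScalars A)

/-- The Hilbert function `t ↦ dim_{k(𝔭)} (Q_t ⊗_A k(𝔭))` of the fiber `Q ⊗_A k(𝔭)`, the graded
module with graded pieces `Q_t ⊗_A k(𝔭)`. -/
noncomputable def fiberHilbertFunction (N : Submodule (PolyRing A r) (FreeMod A r p))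
    (𝔭 : PrimeSpectrum A) (t : ℕ) : ℕ :=
  Module.finrank 𝔭.asIdeal.ResidueField (𝔭.asIdeal.ResidueField ⊗[A] quotPiece N t)

end GradedPieces

/-- `P` is the Hilbert polynomial of a graded module with Hilbert function `h`: the two agree in
all sufficiently large degrees. -/
def IsHilbertPolynomial (h : ℕ → ℕ) (P : Polynomial ℚ) : Prop :=
  ∀ᶠ t : ℕ in Filter.atTop, (h t : ℚ) = P.eval (t : ℚ)

section Modules

variable (A : Type*) [CommRing A] (L : Type*) [AddCommGroup L] [Module A L]

/-- `L` is locally free of rank `n`: every prime has a basic open neighbourhood `D(f)` over which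
`L_f` is isomorphic to `(A_f)^n`. -/
def IsLocallyFreeOfRank (n : ℕ) : Prop :=
  ∀ 𝔭 : PrimeSpectrum A, ∃ f : A, f ∉ 𝔭.asIdeal ∧
    Nonempty (LocalizedModule (Submonoid.powers f) L ≃ₗ[Localization (Submonoid.powers f)]
      (Fin n → Localization (Submonoid.powers f)))

variable {A}

/-- The ideal generated by the `k`-minors of a matrix with possibly infinitely many columns.
(Repeated rows or columns contribute `0`, reordering them changes a sign, and the `0`-minor
is `1`.) -/
def minorsIdeal {m : ℕ} {κ : Type*} (B : Matrix (Fin m) κ A) (k : ℕ) : Ideal A :=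
  Ideal.span {x | ∃ (a : Fin k → Fin m) (b : Fin k → κ), x = (B.submatrix a b).det}

variable {L}

/-- The matrix of the free presentation `A^(ker π) → A^m → L → 0` given by a surjection
`π : A^m → L`; its columns are all the elements of `ker π`. -/
def relationMatrix {m : ℕ} (π : (Fin m → A) →ₗ[A] L) : Matrix (Fin m) (LinearMap.ker π) A :=
  Matrix.of fun a v => (v : Fin m → A) a

variable (A L)

/-- The Fitting ideal `Fitt_i(L)` of a finitely generated module `L`: the ideal generated by the
`(m - i)`-minors of the matrix of a free presentation `F → A^m → L → 0` (the unit ideal if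
`m - i ≤ 0`). As this ideal does not depend on the presentation, we avoid a choice by taking the
supremum over all surjections `A^m → L`. The index is an integer, so that `Fitt_{-1}(L) = 0`
for finitely generated `L`. -/
def fittingIdeal (i : ℤ) : Ideal A :=
  ⨆ (m : ℕ) (π : (Fin m → A) →ₗ[A] L) (_ : Function.Surjective π),
    minorsIdeal (relationMatrix π) ((m : ℤ) - i).toNat

end Modules

section Towers

variable {A : Type*} [CommRing A] {ι : Type*} [Fintype ι]
  {Q : ℕ → Type*} [∀ t, AddCommGroup (Q t)] [∀ t, Module A (Q t)]

/-- Commuting degree one operators `X i` on a graded module that is generated in degree `0`. -/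
structure IsTower (X : ∀ t, ι → Q t →ₗ[A] Q (t + 1)) : Prop where
  comm : ∀ t i j q, X (t + 1) i (X t j q) = X (t + 1) j (X t i q)
  span : ∀ t (y : Q (t + 1)), ∃ q : ι → Q t, ∑ i, X t i (q i) = y

/-- The operator given by the linear form with coefficients `c`. -/
def linearForm (X : ∀ t, ι → Q t →ₗ[A] Q (t + 1)) (c : ι → A) (t : ℕ) : Q t →ₗ[A] Q (t + 1) :=
  ∑ i, c i • X t i

variable {X : ∀ t, ι → Q t →ₗ[A] Q (t + 1)}

theorem linearForm_apply (c : ι → A) (t : ℕ) (q : Q t) :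
    linearForm X c t q = ∑ i, c i • X t i q := by
  simp [linearForm]

theorem linearForm_add (c c' : ι → A) (t : ℕ) :
    linearForm X (c + c') t = linearForm X c t + linearForm X c' t := by
  simp [linearForm, add_smul, Finset.sum_add_distrib]

theorem linearForm_smul_single [DecidableEq ι] (a : A) (i : ι) (t : ℕ) :
    linearForm X (a • Pi.single i 1) t = a • X t i := by
  ext q
  simp [linearForm_apply, Pi.single_apply]

namespace IsTower

theorem linearForm_X (hX : IsTower X) (c : ι → A) (t : ℕ) (i : ι) (q : Q t) :
    linearForm X c (t + 1) (X t i q) = X (t + 1) i (linearForm X c t q) := by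
  simp [linearForm_apply, hX.comm t _ i]

theorem linearForm_comm (hX : IsTower X) (c c' : ι → A) (t : ℕ) (q : Q t) :
    linearForm X c (t + 1) (linearForm X c' t q) =
      linearForm X c' (t + 1) (linearForm X c t q) := by
  rw [linearForm_apply c' t, map_sum, linearForm_apply c' (t + 1)]
  simp [hX.linearForm_X]

/-- The operators on the submodule `ℓ Q`, for a linear form `ℓ`. -/
def imageOperator (hX : IsTower X) (c : ι → A) (t : ℕ) (i : ι) :
    LinearMap.range (linearForm X c t) →ₗ[A] LinearMap.range (linearForm X c (t + 1)) :=
  (X (t + 1) i).restrict (by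
    rintro _ ⟨q, rfl⟩
    exact ⟨X t i q, hX.linearForm_X c t i q⟩)

theorem imageOperator_coe (hX : IsTower X) (c : ι → A) (t : ℕ) (i : ι)
    (q : LinearMap.range (linearForm X c t)) :
    (hX.imageOperator c t i q : Q (t + 1 + 1)) = X (t + 1) i q := rfl

theorem isTower_image (hX : IsTower X) (c : ι → A) : IsTower (hX.imageOperator c) where
  comm t i j q := Subtype.ext (hX.comm (t + 1) i j q)
  span := by
    rintro t ⟨_, y, rfl⟩
    obtain ⟨q, rfl⟩ := hX.span t y
    refine ⟨fun i => ⟨_, q i, rfl⟩, Subtype.ext ?_⟩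
    simp [imageOperator_coe, hX.linearForm_X]

theorem linearForm_image_coe (hX : IsTower X) (c c' : ι → A) (t : ℕ)
    (q : LinearMap.range (linearForm X c t)) :
    (linearForm (hX.imageOperator c) c' t q : Q (t + 1 + 1)) = linearForm X c' (t + 1) q := by
  simp [linearForm_apply, imageOperator_coe]

theorem surjective_succ (hX : IsTower X) {c : ι → A} {t : ℕ}
    (h : Function.Surjective (linearForm X c t)) :
    Function.Surjective (linearForm X c (t + 1)) := by
  intro y
  obtain ⟨q, rfl⟩ := hX.span _ y
  choose q' hq' using fun i => h (q i)
  exact ⟨∑ i, X t i (q' i), by simp [hX.linearForm_X, hq']⟩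

theorem surjective_add (hX : IsTower X) {c : ι → A} {t : ℕ}
    (h : Function.Surjective (linearForm X c t)) (s : ℕ) :
    Function.Surjective (linearForm X c (t + s)) := by
  induction s with
  | zero => exact h
  | succ s ih => exact hX.surjective_succ ih

theorem finite (hX : IsTower X) [Module.Finite A (Q 0)] (t : ℕ) : Module.Finite A (Q t) := by
  induction t with
  | zero => infer_instance
  | succ t ih =>
    refine Module.Finite.of_surjective (∑ i, X t i ∘ₗ LinearMap.proj i : (ι → Q t) →ₗ[A] _) ?_
    intro y
    obtain ⟨q, rfl⟩ := hX.span t y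
    exact ⟨q, by simp⟩

end IsTower

end Towers

section Fields

variable {K : Type*} [Field K]

/-- The rank does not drop at all but finitely many members of a pencil of linear maps. -/
theorem finite_setOf_finrank_range_lt {U W : Type*} [AddCommGroup U] [Module K U]
    [AddCommGroup W] [Module K W] [Module.Finite K W] (f h : U →ₗ[K] W) :
    {s : K | Module.finrank K (LinearMap.range (f + s • h)) <
      Module.finrank K (LinearMap.range f)}.Finite := by
  classical
  set ρ := Module.finrank K (LinearMap.range f)
  let b := Module.finBasis K (LinearMap.range f)
  choose u hu using fun j => (b j).2
  let T : (Fin ρ → K) →ₗ[K] U := Fintype.linearCombination K u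
  have hinj : LinearMap.ker (f ∘ₗ T) = ⊥ := by
    rw [LinearMap.ker_eq_bot']
    intro v hv
    have : ∑ j, v j • b j = 0 := by
      apply Subtype.ext
      simpa [T, Fintype.linearCombination_apply, hu] using hv
    exact funext (Fintype.linearIndependent_iff.1 b.linearIndependent v this)
  obtain ⟨g, hg⟩ := (f ∘ₗ T).exists_leftInverse_of_injective hinj
  let M : Matrix (Fin ρ) (Fin ρ) K := LinearMap.toMatrix' (g ∘ₗ h ∘ₗ T)
  let P : Polynomial K := (1 + (Polynomial.X : Polynomial K) • M.map Polynomial.C).det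
  have hP (s : K) : P.eval s = (1 + s • M).det := by
    rw [← Polynomial.coe_evalRingHom, RingHom.map_det]
    congr 1
    ext i j
    simp [Matrix.one_apply, apply_ite]
    ring
  have hP0 : P ≠ 0 := by
    intro h0
    have := hP 0
    simp [h0] at this
  refine (P.roots.toFinset.finite_toSet).subset fun s hs => ?_
  simp only [Finset.mem_coe, Multiset.mem_toFinset, Polynomial.mem_roots hP0, Polynomial.IsRoot.def]
  by_contra hne
  rw [hP] at hne
  have hM : 1 + s • M = LinearMap.toMatrix' (g ∘ₗ (f + s • h) ∘ₗ T) := by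
    rw [LinearMap.add_comp, LinearMap.comp_add, hg, LinearMap.smul_comp, LinearMap.comp_smul]
    simp [M]
  have hbij : LinearMap.range (g ∘ₗ (f + s • h) ∘ₗ T) = ⊤ := by
    apply LinearMap.range_eq_top.2
    have hu := (Matrix.isUnit_iff_isUnit_det _).2 (isUnit_iff_ne_zero.2 hne)
    have := Matrix.mulVec_surjective_iff_isUnit.2 hu
    rw [hM] at this
    intro y
    obtain ⟨x, hx⟩ := this y
    exact ⟨x, by rwa [LinearMap.toMatrix'_mulVec] at hx⟩
  have h1 : LinearMap.range (g ∘ₗ (f + s • h) ∘ₗ T) ≤ (LinearMap.range (f + s • h)).map g := by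
    rintro _ ⟨x, rfl⟩
    exact ⟨_, ⟨T x, rfl⟩, rfl⟩
  have h2 := Submodule.finrank_mono h1
  rw [hbij, finrank_top, Module.finrank_fin_fun] at h2
  have h3 := Submodule.finrank_map_le g (LinearMap.range (f + s • h))
  exact absurd hs (not_lt.2 (h2.trans h3))

variable [Infinite K] {ι : Type*} [Fintype ι]

/-- Over an infinite field, if the degree `d + 1` piece has dimension at most `d + 1`, then it is
the image of the degree `d` piece under some linear form. -/
theorem exists_linearForm_surjective_of_finrank_le (d : ℕ) :
    ∀ {Q : ℕ → Type*} [∀ t, AddCommGroup (Q t)] [∀ t, Module K (Q t)]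
      [∀ t, Module.Finite K (Q t)] {X : ∀ t, ι → Q t →ₗ[K] Q (t + 1)},
      IsTower X → Module.finrank K (Q (d + 1)) ≤ d + 1 →
        ∃ c : ι → K, Function.Surjective (linearForm X c d) := by
  classical
  induction d with
  | zero =>
    intro Q _ _ _ X hX hd
    by_contra! hns
    have hzero (i : ι) (q : Q 0) : X 0 i q = 0 := by
      by_contra hne
      refine hns ((1 : K) • Pi.single i 1) ?_
      rw [linearForm_smul_single, one_smul]
      intro y
      have h1 : Module.finrank K (Q (0 + 1)) = 1 :=
        le_antisymm (by simpa using hd)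
          (Module.finrank_pos_iff_exists_ne_zero.2 ⟨_, hne⟩)
      obtain ⟨a, rfl⟩ := exists_smul_eq_of_finrank_eq_one h1 hne y
      exact ⟨a • q, by simp⟩
    refine hns 0 fun y => ⟨0, ?_⟩
    obtain ⟨q, rfl⟩ := hX.span 0 y
    simp [hzero]
  | succ d ih =>
    intro Q _ _ _ X hX hd
    let rk (c : ι → K) : ℕ := Module.finrank K (LinearMap.range (linearForm X c (d + 1)))
    obtain ⟨c, hc⟩ : ∃ c, ∀ c', rk c' ≤ rk c := by
      have hb : BddAbove (Set.range rk) := ⟨Module.finrank K (Q (d + 1 + 1)), by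
        rintro _ ⟨c, rfl⟩
        exact Submodule.finrank_le _⟩
      obtain ⟨c, hc⟩ := Nat.sSup_mem (Set.range_nonempty rk) hb
      exact ⟨c, fun c' => hc ▸ le_csSup hb ⟨c', rfl⟩⟩
    refine ⟨c, ?_⟩
    by_contra hns
    have hlt : rk c < Module.finrank K (Q (d + 1 + 1)) :=
      Submodule.finrank_lt fun h => hns (LinearMap.range_eq_top.1 h)
    obtain ⟨c', hc'⟩ := ih (hX.isTower_image c) (by change rk c ≤ _; omega)
    -- A linear form that does not drop the rank on `ℓ Q` has the same image as `ℓ`.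
    have key (c'' : ι → K) (h : rk c ≤ Module.finrank K
        (LinearMap.range (linearForm X c'' (d + 1) ∘ₗ linearForm X c d))) :
        LinearMap.range (linearForm X c'' (d + 1)) =
          LinearMap.range (linearForm X c (d + 1)) := by
      have h1 : LinearMap.range (linearForm X c'' (d + 1) ∘ₗ linearForm X c d) ≤
          LinearMap.range (linearForm X c'' (d + 1)) := LinearMap.range_comp_le_range _ _
      have h2 : LinearMap.range (linearForm X c'' (d + 1) ∘ₗ linearForm X c d) ≤
          LinearMap.range (linearForm X c (d + 1)) := by
        rintro _ ⟨q, rfl⟩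
        exact ⟨linearForm X c'' d q, hX.linearForm_comm c c'' d q⟩
      rw [← Submodule.eq_of_le_of_finrank_le h1 ((hc c'').trans h),
        Submodule.eq_of_le_of_finrank_le h2 h]
    have hc'' : LinearMap.range (linearForm X c' (d + 1) ∘ₗ linearForm X c d) =
        LinearMap.range (linearForm X c (d + 1)) := by
      apply le_antisymm
      · rintro _ ⟨q, rfl⟩
        exact ⟨linearForm X c' d q, hX.linearForm_comm c c' d q⟩
      · intro y hy
        obtain ⟨⟨_, q, rfl⟩, hq⟩ := hc' ⟨y, hy⟩
        refine ⟨q, ?_⟩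
        have := congrArg Subtype.val hq
        rwa [hX.linearForm_image_coe] at this
    have hX' (i : ι) (q : Q (d + 1)) :
        X (d + 1) i q ∈ LinearMap.range (linearForm X c (d + 1)) := by
      have hfin := finite_setOf_finrank_range_lt
        (linearForm X c' (d + 1) ∘ₗ linearForm X c d) (X (d + 1) i ∘ₗ linearForm X c d)
      obtain ⟨s, hs⟩ := (hfin.union (Set.finite_singleton 0)).exists_notMem
      simp only [Set.mem_union, Set.mem_ofPred_eq, Set.mem_singleton_iff, not_or, not_lt] at hs
      obtain ⟨hs, hs0⟩ := hs
      rw [hc'', ← LinearMap.smul_comp, ← LinearMap.add_comp, ← linearForm_smul_single,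
        ← linearForm_add] at hs
      have h1 := key _ hs
      have h2 := key c' (by rw [hc''])
      have h3 : s • X (d + 1) i q ∈ LinearMap.range (linearForm X c (d + 1)) := by
        have e : s • X (d + 1) i q = linearForm X (c' + s • Pi.single i 1) (d + 1) q -
            linearForm X c' (d + 1) q := by
          rw [linearForm_add, linearForm_smul_single]
          simp
        rw [e]
        exact sub_mem (h1 ▸ LinearMap.mem_range_self _ q) (h2 ▸ LinearMap.mem_range_self _ q)
      exact (Submodule.smul_mem_iff _ hs0).1 h3
    apply hns
    intro y
    obtain ⟨q, rfl⟩ := hX.span _ y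
    exact Submodule.sum_mem _ fun i _ => hX' i (q i)

end Fields

section Koszul

variable {A : Type*} [CommRing A] {ι : Type*} [Fintype ι]
  {Q : ℕ → Type*} [∀ t, AddCommGroup (Q t)] [∀ t, Module A (Q t)]

/-- Exactness of `⨁_{i, j} Q_t → ⨁_i Q_{t+1} → Q_{t+2}`. -/
def IsKoszulExactAt (X : ∀ t, ι → Q t →ₗ[A] Q (t + 1)) (t : ℕ) : Prop :=
  ∀ q : ι → Q (t + 1), ∑ i, X (t + 1) i (q i) = 0 →
    ∃ w : ι → ι → Q t, ∀ i, q i = ∑ j, (X t j (w i j) - X t j (w j i))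

variable {X : ∀ t, ι → Q t →ₗ[A] Q (t + 1)}

theorem IsTower.injective_of_isKoszulExactAt (hX : IsTower X) {c : ι → A} {t : ℕ}
    (hs : Function.Surjective (linearForm X c t))
    (hb : Function.Bijective (linearForm X c (t + 1))) (hK : IsKoszulExactAt X (t + 1)) :
    Function.Injective (linearForm X c (t + 2)) := by
  rw [injective_iff_map_eq_zero]
  intro q hq
  let e := LinearEquiv.ofBijective (linearForm X c (t + 1)) hb
  have he (y) : linearForm X c (t + 1) (e.symm y) = y := e.apply_symm_apply y
  have hcomm (i j : ι) (w : Q (t + 1)) :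
      X (t + 1) i (e.symm (X (t + 1) j w)) = X (t + 1) j (e.symm (X (t + 1) i w)) := by
    obtain ⟨w, rfl⟩ := hs w
    have h (i : ι) : e.symm (X (t + 1) i (linearForm X c t w)) = X t i w := by
      rw [← hX.linearForm_X, LinearEquiv.symm_apply_eq]
      rfl
    rw [h, h, hX.comm]
  obtain ⟨w, hw⟩ := hK (fun i => c i • q) (by simpa [linearForm_apply] using hq)
  calc q = ∑ i, X (t + 1) i (e.symm (c i • q)) := by
        conv_lhs => rw [← he q, linearForm_apply]
        simp
    _ = ∑ i, ∑ j, X (t + 1) i (e.symm (X (t + 1) j (w i j))) -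
        ∑ i, ∑ j, X (t + 1) i (e.symm (X (t + 1) j (w j i))) := by
        simp [hw]
    _ = 0 := by
        rw [sub_eq_zero]
        conv_rhs => rw [Finset.sum_comm]
        simp only [hcomm]

theorem IsTower.subsingleton (hX : IsTower X) [Subsingleton (Q 0)] (t : ℕ) : Subsingleton (Q t) := by
  induction t with
  | zero => infer_instance
  | succ t ih =>
    refine subsingleton_of_forall_eq 0 fun y => ?_
    obtain ⟨q, rfl⟩ := hX.span t y
    simp [Subsingleton.elim (q _) 0]

/-- The `s`-th power of a linear form. -/
def linearFormPow (X : ∀ t, ι → Q t →ₗ[A] Q (t + 1)) (c : ι → A) (d : ℕ) :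
    ∀ s, Q d →ₗ[A] Q (d + s)
  | 0 => LinearMap.id
  | s + 1 => linearForm X c (d + s) ∘ₗ linearFormPow X c d s

section BaseChange

variable (B : Type*) [CommRing B] [Algebra A B]

theorem linearForm_baseChange (c : ι → A) (t : ℕ) :
    linearForm (fun t i => (X t i).baseChange B) (fun i => algebraMap A B (c i)) t =
      (linearForm X c t).baseChange B := by
  ext q
  simp [linearForm_apply, TensorProduct.tmul_sum]

theorem IsTower.baseChange (hX : IsTower X) : IsTower fun t i => (X t i).baseChange B where
  comm t i j q := by
    induction q with
    | zero => simp
    | add x y hx hy => simp only [map_add, hx, hy]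
    | tmul b q => simp [hX.comm t i j q]
  span t y := by
    induction y with
    | zero => exact ⟨0, by simp⟩
    | add x y hx hy =>
      obtain ⟨q, rfl⟩ := hx
      obtain ⟨q', rfl⟩ := hy
      exact ⟨q + q', by simp [Finset.sum_add_distrib]⟩
    | tmul b y =>
      obtain ⟨q, rfl⟩ := hX.span t y
      exact ⟨fun i => b ⊗ₜ q i, by simp [TensorProduct.tmul_sum]⟩

theorem IsKoszulExactAt.baseChange (hX : IsTower X) {t : ℕ} (hK : IsKoszulExactAt X t) :
    IsKoszulExactAt (fun t i => (X t i).baseChange B) t := by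
  classical
  intro q hq
  let g : (ι → Q (t + 1)) →ₗ[A] Q (t + 1 + 1) := ∑ i, X (t + 1) i ∘ₗ LinearMap.proj i
  let f : (ι → ι → Q t) →ₗ[A] (ι → Q (t + 1)) := LinearMap.pi fun i =>
    ∑ j, (X t j ∘ₗ LinearMap.proj j ∘ₗ LinearMap.proj i -
      X t j ∘ₗ LinearMap.proj i ∘ₗ LinearMap.proj j)
  have hg : Function.Surjective g := fun y => by
    obtain ⟨q, rfl⟩ := hX.span _ y
    exact ⟨q, by simp [g]⟩
  have hfg : Function.Exact f g := by
    intro q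
    constructor
    · intro h
      obtain ⟨w, hw⟩ := hK q (by simpa [g] using h)
      exact ⟨w, funext fun i => by simp [f, hw]⟩
    · rintro ⟨w, rfl⟩
      simp only [g, f, LinearMap.sum_apply, LinearMap.comp_apply, LinearMap.proj_apply,
        LinearMap.pi_apply, LinearMap.sub_apply, map_sum, map_sub, Finset.sum_sub_distrib]
      rw [sub_eq_zero]
      conv_rhs => rw [Finset.sum_comm]
      simp only [hX.comm t]
  have hB := lTensor_exact B hfg hg
  have hpg (z : B ⊗[A] (ι → Q (t + 1))) : g.lTensor B z =
      ∑ i, (X (t + 1) i).baseChange B ((LinearMap.proj i).lTensor B z) := by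
    induction z with
    | zero => simp
    | add x y hx hy => simp only [map_add, hx, hy, Finset.sum_add_distrib]
    | tmul b z => simp [g, TensorProduct.tmul_sum]
  have hpf (z : B ⊗[A] (ι → ι → Q t)) (i : ι) :
      (LinearMap.proj i).lTensor B (f.lTensor B z) =
        ∑ j, ((X t j).baseChange B ((LinearMap.proj j ∘ₗ LinearMap.proj i).lTensor B z) -
          (X t j).baseChange B ((LinearMap.proj i ∘ₗ LinearMap.proj j).lTensor B z)) := by
    induction z with
    | zero => simp
    | add x y hx hy =>
      simp only [map_add, hx, hy, ← Finset.sum_add_distrib]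
      exact Finset.sum_congr rfl fun j _ => by abel
    | tmul b z => simp [f, TensorProduct.tmul_sum, TensorProduct.tmul_sub]
  let z : B ⊗[A] (ι → Q (t + 1)) := ∑ i, (LinearMap.single A (fun _ => Q (t + 1)) i).lTensor B (q i)
  have hz (i : ι) : (LinearMap.proj i).lTensor B z = q i := by
    simp only [z, map_sum, ← LinearMap.comp_apply, ← LinearMap.lTensor_comp]
    rw [Finset.sum_eq_single i]
    · rw [LinearMap.proj_comp_single_same, LinearMap.lTensor_id, LinearMap.id_apply]
    · intro j _ hj
      rw [LinearMap.proj_comp_single_ne _ _ _ _ hj.symm, LinearMap.lTensor_zero,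
        LinearMap.zero_apply]
    · simp
  obtain ⟨w, hw⟩ := (hB z).1 (by rw [hpg]; simpa [hz] using hq)
  exact ⟨fun i j => (LinearMap.proj j ∘ₗ LinearMap.proj i).lTensor B w, fun i => by
    rw [← hz, ← hw, hpf]⟩

end BaseChange

end Koszul

section Local

variable {B : Type*} [CommRing B] [IsLocalRing B]

theorem surjective_of_surjective_baseChange_residueField {M N : Type*} [AddCommGroup M] [Module B M]
    [AddCommGroup N] [Module B N] [Module.Finite B N] (f : M →ₗ[B] N)
    (h : Function.Surjective (f.baseChange (IsLocalRing.ResidueField B))) :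
    Function.Surjective f := by
  have hs := IsLocalRing.subsingleton_tensorProduct (R := B) (M := N ⧸ LinearMap.range f)
  rw [← LinearMap.range_eq_top, ← Submodule.Quotient.subsingleton_iff, ← hs]
  refine subsingleton_of_forall_eq 0 fun y => ?_
  obtain ⟨y, rfl⟩ := (LinearMap.range f).mkQ.lTensor_surjective _
    (Submodule.mkQ_surjective _) y
  obtain ⟨x, rfl⟩ := h y
  induction x with
  | zero => simp
  | add x y hx hy => simp only [map_add, hx, hy, add_zero]
  | tmul b x =>
    have : (LinearMap.range f).mkQ (f x) = 0 :=
      (Submodule.Quotient.mk_eq_zero _).2 (LinearMap.mem_range_self f x)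
    simp only [LinearMap.baseChange_tmul, LinearMap.lTensor_tmul, this, TensorProduct.tmul_zero]

variable [Infinite (IsLocalRing.ResidueField B)] {ι : Type*} [Fintype ι]
  {Q : ℕ → Type*} [∀ t, AddCommGroup (Q t)] [∀ t, Module B (Q t)] [Module.Finite B (Q 0)]
  {X : ∀ t, ι → Q t →ₗ[B] Q (t + 1)}

namespace IsTower

theorem exists_linearForm_surjective (hX : IsTower X) {n d : ℕ} (e : Q (d + 1) ≃ₗ[B] (Fin n → B))
    (hnd : n ≤ d + 1) : ∃ c : ι → B, Function.Surjective (linearForm X c d) := by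
  have := hX.finite
  have : Module.Free B (Q (d + 1)) := Module.Free.of_equiv e.symm
  obtain ⟨c, hc⟩ := exists_linearForm_surjective_of_finrank_le d
    (hX.baseChange (IsLocalRing.ResidueField B)) (by
      rw [Module.finrank_baseChange, e.finrank_eq, Module.finrank_fin_fun]
      exact hnd)
  choose c' hc' using fun i => IsLocalRing.residue_surjective (c i)
  refine ⟨c', surjective_of_surjective_baseChange_residueField _ ?_⟩
  rw [← linearForm_baseChange]
  have hcc : (fun i => algebraMap B (IsLocalRing.ResidueField B) (c' i)) = c := funext hc'
  rw [hcc]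
  exact hc

theorem exists_surjective_fin (hX : IsTower X) {n d : ℕ} (e : Q d ≃ₗ[B] (Fin n → B))
    (hnd : n ≤ d) (s : ℕ) : ∃ σ : (Fin n → B) →ₗ[B] Q (d + s), Function.Surjective σ := by
  obtain _ | d := d
  · obtain rfl : n = 0 := by omega
    have := e.toEquiv.subsingleton
    have := hX.subsingleton (0 + s)
    exact ⟨0, fun y => ⟨0, Subsingleton.elim _ _⟩⟩
  · obtain ⟨c, hc⟩ := hX.exists_linearForm_surjective e hnd
    induction s with
    | zero => exact ⟨e.symm, e.symm.surjective⟩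
    | succ s ih =>
      obtain ⟨σ, hσ⟩ := ih
      exact ⟨linearForm X c (d + 1 + s) ∘ₗ σ,
        (hX.surjective_add (hX.surjective_succ hc) s).comp hσ⟩

theorem nonempty_equiv_iff (hX : IsTower X) {n d : ℕ} (hK : ∀ t, d ≤ t + 1 → IsKoszulExactAt X t)
    (e : Q d ≃ₗ[B] (Fin n → B)) (hnd : n ≤ d) (s : ℕ) :
    Nonempty (Q (d + (s + 1)) ≃ₗ[B] (Fin n → B)) ↔
      Nonempty (Q (d + 1) ≃ₗ[B] (Fin n → B)) := by
  obtain _ | d := d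
  · obtain rfl : n = 0 := by omega
    have := e.toEquiv.subsingleton
    have := hX.subsingleton
    exact ⟨fun _ => ⟨0, 0, fun _ => Subsingleton.elim _ _, fun _ => Subsingleton.elim _ _⟩,
      fun _ => ⟨0, 0, fun _ => Subsingleton.elim _ _, fun _ => Subsingleton.elim _ _⟩⟩
  have hfin := hX.finite
  obtain ⟨c, hc⟩ := hX.exists_linearForm_surjective e hnd
  have hs := fun s => hX.surjective_add (hX.surjective_succ hc) s
  have hpow (s : ℕ) : Function.Surjective (linearFormPow X c (d + 1) s) := by
    induction s with
    | zero => exact Function.surjective_id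
    | succ s ih => exact (hs s).comp ih
  -- A surjection between free modules of the same rank is injective.
  have hbij {t : ℕ} (f : Q (d + 1) →ₗ[B] Q t) (hf : Function.Surjective f)
      (e' : Q t ≃ₗ[B] (Fin n → B)) : Function.Injective f := by
    have := OrzechProperty.injective_of_surjective_endomorphism
      ((e'.trans e.symm).toLinearMap ∘ₗ f) ((e'.trans e.symm).surjective.comp hf)
    exact Function.Injective.of_comp (f := e'.trans e.symm) this
  constructor
  · rintro ⟨e'⟩
    have hinj : Function.Injective (linearForm X c (d + 1)) := by
      have := hbij _ (hpow (s + 1)) e'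
      clear e'
      induction s with
      | zero => exact this
      | succ s ih => exact ih (Function.Injective.of_comp this)
    exact ⟨(LinearEquiv.ofBijective _ ⟨hinj, hs 0⟩).symm.trans e⟩
  · rintro ⟨e'⟩
    have hb (s : ℕ) : Function.Bijective (linearForm X c (d + s + 1)) := by
      induction s with
      | zero => exact ⟨hbij _ (hs 0) e', hs 0⟩
      | succ s ih =>
        exact ⟨hX.injective_of_isKoszulExactAt (hX.surjective_add hc s) ih
          (hK (d + s + 1) (by omega)),
          hX.surjective_succ ih.2⟩
    have hfree (s : ℕ) : Nonempty (Q (d + 1 + s) ≃ₗ[B] (Fin n → B)) := by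
      induction s with
      | zero => exact ⟨e⟩
      | succ s ih =>
        obtain ⟨e''⟩ := ih
        have hb' : Function.Bijective (linearForm X c (d + 1 + s)) := by
          rw [Nat.add_right_comm]
          exact hb s
        exact ⟨(LinearEquiv.ofBijective _ hb').symm.trans e''⟩
    exact hfree (s + 1)

end IsTower

end Local

section Minors

theorem Matrix.det_mul_eq_zero_of_card_lt {B α β : Type*} [CommRing B] [Fintype α] [DecidableEq α]
    [Fintype β] (h : Fintype.card β < Fintype.card α) (C : Matrix α β B) (D : Matrix β α B) :
    (C * D).det = 0 := by
  classical
  let γ := Fin (Fintype.card α - Fintype.card β)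
  let e : α ≃ β ⊕ γ := Fintype.equivOfCardEq (by simp [γ]; omega)
  let j : γ := ⟨0, by omega⟩
  have hCD : C * D = (Matrix.fromCols C (0 : Matrix α γ B)).submatrix id e *
      (Matrix.fromRows D (0 : Matrix γ α B)).submatrix e id := by
    rw [Matrix.submatrix_mul_equiv, Matrix.fromCols_mul_fromRows]
    simp
  rw [hCD, Matrix.det_mul, Matrix.det_eq_zero_of_column_eq_zero (e.symm (Sum.inr j)), zero_mul]
  simp

/-- A multilinear map that vanishes on a set vanishes on its span. -/
theorem MultilinearMap.eq_zero_of_mem_span {B E F κ : Type*} [CommRing B] [AddCommGroup E]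
    [Module B E] [AddCommGroup F] [Module B F] [Finite κ]
    (f : MultilinearMap B (fun _ : κ => E) F) {s : Set E} (hs : ∀ v : κ → E, (∀ i, v i ∈ s) → f v = 0)
    (v : κ → E) (hv : ∀ i, v i ∈ Submodule.span B s) : f v = 0 := by
  classical
  have := Fintype.ofFinite κ
  choose n b g hg using fun i => Submodule.mem_span_set'.1 (hv i)
  obtain rfl : (fun i => ∑ j, b i j • (g i j : E)) = v := funext hg
  rw [MultilinearMap.map_sum]
  refine Finset.sum_eq_zero fun r _ => ?_
  rw [MultilinearMap.map_smul_univ f (fun i => b i (r i)) (fun i => (g i (r i) : E)),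
    hs _ fun i => (g i (r i)).2, smul_zero]

variable {A : Type*} [CommRing A] {B : Type*} [CommRing B] [Algebra A B]
  {L : Type*} [AddCommGroup L] [Module A L] {m n : ℕ}

/-- The base change of `π : A^m → L`. -/
noncomputable def finBaseChange (B : Type*) [CommRing B] [Algebra A B]
    (π : (Fin m → A) →ₗ[A] L) : (Fin m → B) →ₗ[B] B ⊗[A] L :=
  π.baseChange B ∘ₗ (TensorProduct.piScalarRight A B B (Fin m)).symm.toLinearMap

variable {π : (Fin m → A) →ₗ[A] L}

theorem finBaseChange_algebraMap (v : Fin m → A) :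
    finBaseChange B π (fun i => algebraMap A B (v i)) = 1 ⊗ₜ π v := by
  have : (TensorProduct.piScalarRight A B B (Fin m)).symm (fun i => algebraMap A B (v i)) =
      1 ⊗ₜ v := by
    rw [LinearEquiv.symm_apply_eq]
    ext i
    simp [Algebra.algebraMap_eq_smul_one]
  simp [finBaseChange, this]

theorem finBaseChange_surjective (hπ : Function.Surjective π) :
    Function.Surjective (finBaseChange B π) :=
  (LinearMap.lTensor_surjective B hπ).comp (LinearEquiv.surjective _)

theorem ker_finBaseChange_le (hπ : Function.Surjective π) :
    LinearMap.ker (finBaseChange B π) ≤ Submodule.span B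
      ((fun v : Fin m → A => fun i => algebraMap A B (v i)) '' LinearMap.ker π) := by
  intro v hv
  obtain ⟨z, hz⟩ := (lTensor_exact B (LinearMap.exact_subtype_ker_map π) hπ
    ((TensorProduct.piScalarRight A B B (Fin m)).symm v)).1 hv
  obtain rfl : TensorProduct.piScalarRight A B B (Fin m)
      ((LinearMap.ker π).subtype.lTensor B z) = v := by
    rw [hz, LinearEquiv.apply_symm_apply]
  clear hz hv
  induction z with
  | zero => simp
  | add x y hx hy =>
    rw [map_add, map_add]
    exact add_mem hx hy
  | tmul b x =>
    have : TensorProduct.piScalarRight A B B (Fin m)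
        ((LinearMap.ker π).subtype.lTensor B (b ⊗ₜ x)) =
        b • (fun i => algebraMap A B ((x : Fin m → A) i)) := by
      ext i
      simp [Algebra.algebraMap_eq_smul_one]
    rw [this]
    exact Submodule.smul_mem _ _ (Submodule.subset_span ⟨x, x.2, rfl⟩)

/-- The minors of the relations between too many generators of a free module vanish. -/
theorem det_eq_zero_of_mem_ker {k : ℕ} (hk : m < k + n) (ρ : (Fin m → B) →ₗ[B] (Fin n → B))
    (hρ : Function.Surjective ρ) (a : Fin k → Fin m) (v : Fin k → Fin m → B)
    (hv : ∀ j, ρ (v j) = 0) : (Matrix.of fun i j => v j (a i)).det = 0 := by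
  obtain ⟨σ, hσ⟩ := ρ.exists_rightInverse_of_surjective (LinearMap.range_eq_top.2 hρ)
  let V : Matrix (Fin m) (Fin k) B := Matrix.of fun i j => v j i
  let P := LinearMap.toMatrix' ρ
  let R := LinearMap.toMatrix' σ
  have hPR : P * R = 1 := by
    rw [← LinearMap.toMatrix'_comp, hσ, LinearMap.toMatrix'_id]
  have hPV : P * V = 0 := by
    ext i j
    have := congrFun (hv j) i
    rw [← LinearMap.toMatrix'_mulVec] at this
    exact this
  let E : Matrix (Fin k) (Fin m) B := (1 : Matrix (Fin m) (Fin m) B).submatrix a id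
  have hEV : E * V = Matrix.of fun i j => v j (a i) := by
    ext i j
    simp [E, V, Matrix.mul_apply, Matrix.one_apply]
  have h0 := Matrix.det_mul_eq_zero_of_card_lt (by simpa using hk) (Matrix.fromRows E P)
    (Matrix.fromCols V R)
  rwa [Matrix.fromRows_mul_fromCols, hPR, hPV, Matrix.det_fromBlocks_zero₂₁, Matrix.det_one,
    mul_one, hEV] at h0

theorem algebraMap_eq_zero_of_mem_fittingIdeal [Nontrivial B] (e : B ⊗[A] L ≃ₗ[B] (Fin n → B))
    {x : A} (hx : x ∈ fittingIdeal A L ((n : ℤ) - 1)) : algebraMap A B x = 0 := by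
  suffices h : fittingIdeal A L ((n : ℤ) - 1) ≤ RingHom.ker (algebraMap A B) from h hx
  refine iSup_le fun m => iSup_le fun π => iSup_le fun hπ => Ideal.span_le.2 ?_
  rintro _ ⟨a, b, rfl⟩
  have hs : Function.Surjective (e.toLinearMap ∘ₗ finBaseChange B π) :=
    e.surjective.comp (finBaseChange_surjective hπ)
  have hnm : n ≤ m := le_of_fin_surjective B (e.toLinearMap ∘ₗ finBaseChange B π) hs
  rw [SetLike.mem_coe, RingHom.mem_ker, RingHom.map_det]
  refine det_eq_zero_of_mem_ker (by omega) _ hs a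
    (fun j i => algebraMap A B ((b j : Fin m → A) i)) fun j => ?_
  rw [LinearMap.comp_apply, finBaseChange_algebraMap, (b j).2]
  simp

/-- Among the generators of a module over a local ring one finds a generating set with as many
elements as any other one has. -/
theorem exists_finset_card_eq_span_eq_top [IsLocalRing B] {L : Type*} [AddCommGroup L] [Module B L]
    (hnm : n ≤ m) (g : Fin m → L) (hg : Submodule.span B (Set.range g) = ⊤)
    (σ : (Fin n → B) →ₗ[B] L) (hσ : Function.Surjective σ) :
    ∃ s : Finset (Fin m), s.card = n ∧ Submodule.span B (g '' s) = ⊤ := by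
  classical
  have : Module.Finite B L := Module.Finite.of_surjective σ hσ
  let K := IsLocalRing.ResidueField B
  obtain ⟨κ, a, ha, hsp, hli⟩ := exists_linearIndependent' K (TensorProduct.mk B K L 1 ∘ g)
  have := Finite.of_injective a ha
  have := Fintype.ofFinite κ
  have hcard : Fintype.card κ ≤ n := by
    refine hli.fintype_card_le_finrank.trans ?_
    have := LinearMap.finrank_le_finrank_of_surjective (f := σ.baseChange K)
      (LinearMap.lTensor_surjective K hσ)
    simpa using this
  obtain ⟨s, hs, hsn⟩ := Finset.exists_superset_card_eq (s := Finset.univ.image a) (n := n)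
    (Finset.card_image_le.trans hcard) (by simpa using hnm)
  refine ⟨s, hsn, ?_⟩
  have hspan (t : Set L) : Submodule.span B t = ⊤ ↔
      Submodule.span K (TensorProduct.mk B K L 1 '' t) = ⊤ := by
    rw [← IsLocalRing.map_tensorProduct_mk_eq_top, Submodule.map_span,
      ← Submodule.restrictScalars_span B K Ideal.Quotient.mk_surjective,
      Submodule.restrictScalars_eq_top_iff]
  rw [hspan, ← Set.range_comp, ← hsp] at hg
  rw [hspan, eq_top_iff, ← hg]
  refine Submodule.span_mono ?_
  rintro _ ⟨i, rfl⟩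
  exact ⟨_, ⟨a i, hs (Finset.mem_image_of_mem a (Finset.mem_univ i)), rfl⟩, rfl⟩

theorem exists_equiv_of_minors_eq_zero [IsLocalRing B] {L : Type*} [AddCommGroup L] [Module B L]
    (hnm : n ≤ m) {k : ℕ} (hk : k + n = m + 1) (ρ : (Fin m → B) →ₗ[B] L)
    (hρ : Function.Surjective ρ)
    (h0 : ∀ (a : Fin k → Fin m) (v : Fin k → Fin m → B), (∀ j, ρ (v j) = 0) →
      (Matrix.of fun i j => v j (a i)).det = 0)
    (σ : (Fin n → B) →ₗ[B] L) (hσ : Function.Surjective σ) :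
    Nonempty (L ≃ₗ[B] (Fin n → B)) := by
  classical
  let g (i : Fin m) : L := ρ (Pi.single i 1)
  have hρg (v : Fin m → B) : ρ v = ∑ i, v i • g i := by
    simp only [g, ← map_smul, ← map_sum]
    congr 1
    simpa using (pi_eq_sum_univ' v)
  have hg : Submodule.span B (Set.range g) = ⊤ := by
    rw [eq_top_iff]
    rintro y -
    obtain ⟨v, rfl⟩ := hρ y
    rw [hρg]
    exact Submodule.sum_mem _ fun i _ => Submodule.smul_mem _ _ (Submodule.subset_span ⟨i, rfl⟩)
  obtain ⟨s, hs, hsp⟩ := exists_finset_card_eq_span_eq_top hnm g hg σ hσ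
  let τ : (s → B) →ₗ[B] L := Fintype.linearCombination B fun i : s => g i
  have hτ (v : s → B) : ρ (fun i => if h : i ∈ s then v ⟨i, h⟩ else 0) = τ v := by
    rw [hρg, Fintype.linearCombination_apply, ← Finset.sum_subset (Finset.subset_univ s),
      ← Finset.sum_coe_sort]
    · simp
    · intro i _ hi
      simp [hi]
  have hτs : Function.Surjective τ := by
    rw [← LinearMap.range_eq_top, Fintype.range_linearCombination, ← hsp, Set.image_eq_range]
    rfl
  have hτi : Function.Injective τ := by
    rw [injective_iff_map_eq_zero]
    intro c hc
    ext i
    let β := {j : Fin m // j ∉ s}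
    choose y hy using fun j : β => hτs (g j)
    let ext (v : s → B) (i : Fin m) : B := if h : i ∈ s then v ⟨i, h⟩ else 0
    let a : Unit ⊕ β → Fin m := Sum.elim (fun _ => i) (fun j => j)
    let v : Unit ⊕ β → Fin m → B :=
      Sum.elim (fun _ => ext c) (fun j => Pi.single j.1 1 - ext (y j))
    let ε : Fin k ≃ Unit ⊕ β := Fintype.equivOfCardEq (by
      simp [β, Fintype.card_subtype_compl, hs]
      omega)
    have hdet := h0 (a ∘ ε) (v ∘ ε) (fun j => by
      simp only [Function.comp_apply]
      rcases ε j with _ | j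
      · exact (hτ c).trans hc
      · simp only [v, Sum.elim_inr, map_sub, ext, hτ, hy, sub_self, g])
    have : (Matrix.of fun i j => (v ∘ ε) j ((a ∘ ε) i)) =
        (Matrix.fromBlocks (Matrix.of fun _ _ : Unit => c i)
          (Matrix.of fun (_ : Unit) j => v (Sum.inr j) i) 0 1).submatrix ε ε := by
      ext p q
      simp only [Matrix.of_apply, Matrix.submatrix_apply, Function.comp_apply]
      rcases ε p with p | p <;> rcases ε q with q | q
      · simp [v, a, ext]
      · simp [a]
      · simp [v, a, ext, p.2]
      · simp [v, a, ext, p.2, Matrix.one_apply, Pi.single_apply, Subtype.coe_inj]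
    rw [this, Matrix.det_submatrix_equiv_self, Matrix.det_fromBlocks_zero₂₁] at hdet
    simpa using hdet
  have e : s ≃ Fin n := Fintype.equivOfCardEq (by simp [hs])
  exact ⟨(LinearEquiv.ofBijective τ ⟨hτi, hτs⟩).symm.trans (LinearEquiv.funCongrLeft B B e.symm)⟩

theorem exists_equiv_of_fittingIdeal_map_eq_bot [IsLocalRing B] [Module.Finite A L]
    (h : ∀ x ∈ fittingIdeal A L ((n : ℤ) - 1), algebraMap A B x = 0)
    (σ : (Fin n → B) →ₗ[B] B ⊗[A] L) (hσ : Function.Surjective σ) :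
    Nonempty (B ⊗[A] L ≃ₗ[B] (Fin n → B)) := by
  obtain ⟨m, π, hπ⟩ := Module.Finite.exists_fin' A L
  have hminor : minorsIdeal (relationMatrix π) ((m : ℤ) - ((n : ℤ) - 1)).toNat ≤
      fittingIdeal A L ((n : ℤ) - 1) :=
    le_iSup_of_le m (le_iSup_of_le π (le_iSup_of_le hπ le_rfl))
  have hnm : n ≤ m := by
    by_contra hlt
    have hk : ((m : ℤ) - ((n : ℤ) - 1)).toNat = 0 := by omega
    rw [hk] at hminor
    have := h 1 (hminor (Ideal.subset_span ⟨Fin.elim0, Fin.elim0, by simp⟩))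
    simp at this
  generalize hk : ((m : ℤ) - ((n : ℤ) - 1)).toNat = k at hminor
  refine exists_equiv_of_minors_eq_zero hnm (by omega) (finBaseChange B π)
    (finBaseChange_surjective hπ) (k := k) (fun a v hv => ?_) σ hσ
  let f : MultilinearMap B (fun _ : Fin k => Fin m → B) B :=
    (Matrix.detRowAlternating (R := B) (n := Fin k)).toMultilinearMap.compLinearMap
      fun _ => LinearMap.funLeft B B a
  have hf (v : Fin k → Fin m → B) : f v = (Matrix.of fun i j => v j (a i)).det := by
    rw [← Matrix.det_transpose]
    rfl
  rw [← hf]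
  refine f.eq_zero_of_mem_span (fun w hw => ?_) v fun j => ker_finBaseChange_le hπ (hv j)
  choose u hu huw using hw
  have := h _ (hminor (Ideal.subset_span ⟨a, fun j => ⟨u j, hu j⟩, rfl⟩))
  rw [RingHom.map_det] at this
  rw [hf, ← this]
  congr 1
  ext i j
  simp [← huw, relationMatrix]

end Minors

section Detection

universe u

open Polynomial in
/-- Elements outside an ideal are detected in local rings with infinite residue field. -/
theorem exists_local_algebra_of_notMem {A : Type u} [CommRing A] (I : Ideal A) {x : A}
    (hx : x ∉ I) : ∃ (B : Type u) (_ : CommRing B) (_ : IsLocalRing B) (_ : Algebra A B),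
      Infinite (IsLocalRing.ResidueField B) ∧ (∀ y ∈ I, algebraMap A B y = 0) ∧
        algebraMap A B x ≠ 0 := by
  let R := A ⧸ I
  let y : R := Ideal.Quotient.mk I x
  have hy : y ≠ 0 := fun h => hx (Ideal.Quotient.eq_zero_iff_mem.1 h)
  let J : Ideal R := LinearMap.ker (LinearMap.toSpanSingleton R R y)
  have hmemJ (a : R) : a ∈ J ↔ a * y = 0 := by simp [J]
  have hJ : J ≠ ⊤ := by
    intro h
    apply hy
    simpa using (hmemJ 1).1 (h ▸ Submodule.mem_top)
  obtain ⟨𝔪, h𝔪, hJ𝔪⟩ := Ideal.exists_le_maximal J hJ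
  let 𝔓 : Ideal R[X] := 𝔪.map C
  have h𝔓 : 𝔓.IsPrime := by
    have := h𝔪.isPrime
    exact Ideal.isPrime_map_C_of_isPrime
  refine ⟨Localization.AtPrime 𝔓, inferInstance, inferInstance,
    ((algebraMap R[X] (Localization.AtPrime 𝔓)).comp (C.comp (Ideal.Quotient.mk I))).toAlgebra,
    ?_, ?_, ?_⟩
  · refine Infinite.of_injective (fun i : ℕ =>
      IsLocalRing.residue _ (algebraMap R[X] (Localization.AtPrime 𝔓) (X ^ i))) fun i j hij => ?_
    by_contra hne
    have h := sub_eq_zero.2 hij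
    simp only [← map_sub] at h
    rw [IsLocalRing.residue_eq_zero_iff, IsLocalization.AtPrime.to_map_mem_maximal_iff _ 𝔓,
      Ideal.mem_map_C_iff] at h
    have := h i
    rw [coeff_sub, coeff_X_pow_self, coeff_X_pow, if_neg hne, sub_zero] at this
    exact h𝔪.ne_top ((Ideal.eq_top_iff_one _).2 this)
  · intro z hz
    have : Ideal.Quotient.mk I z = 0 := Ideal.Quotient.eq_zero_iff_mem.2 hz
    rw [RingHom.algebraMap_toAlgebra]
    simp [this]
  · rw [RingHom.algebraMap_toAlgebra]
    intro h
    change algebraMap R[X] (Localization.AtPrime 𝔓) (C y) = 0 at h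
    rw [IsLocalization.map_eq_zero_iff 𝔓.primeCompl] at h
    obtain ⟨s, hs⟩ := h
    refine s.2 (Ideal.mem_map_C_iff.2 fun i => hJ𝔪 ((hmemJ _).2 ?_))
    rw [← coeff_mul_C, hs, coeff_zero]

end Detection

section PolynomialKoszul

open MvPolynomial

variable {σ A : Type*} [CommRing A]

open Classical in
/-- A variable that occurs in a monomial, if there is one. -/
noncomputable def someVariable (μ : σ →₀ ℕ) : Option σ :=
  if h : ∃ j, μ j ≠ 0 then some h.choose else none

theorem apply_ne_zero_of_someVariable {μ : σ →₀ ℕ} {j : σ} (h : someVariable μ = some j) :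
    μ j ≠ 0 := by
  unfold someVariable at h
  split_ifs at h with h'
  obtain rfl := Option.some.inj h
  exact h'.choose_spec

theorem exists_someVariable {μ : σ →₀ ℕ} (h : μ ≠ 0) : ∃ j, someVariable μ = some j := by
  have h' : ∃ j, μ j ≠ 0 := by
    by_contra! h0
    exact h (Finsupp.ext h0)
  exact ⟨h'.choose, by simp [someVariable, h']⟩

open Classical in
/-- The quotient by `X j` of the part of a polynomial made up of the monomials whose chosen
variable is `j`. -/
noncomputable def variableQuotient (j : σ) (p : MvPolynomial σ A) : MvPolynomial σ A :=
  ∑ μ ∈ p.support, if someVariable μ = some j then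
    monomial (μ - Finsupp.single j 1) (coeff μ p) else 0

open Classical in
theorem coeff_variableQuotient (j : σ) (p : MvPolynomial σ A) (ν : σ →₀ ℕ) :
    coeff ν (variableQuotient j p) =
      if someVariable (ν + Finsupp.single j 1) = some j then
        coeff (ν + Finsupp.single j 1) p else 0 := by
  have h (μ : σ →₀ ℕ) : coeff ν (if someVariable μ = some j then
      monomial (μ - Finsupp.single j 1) (coeff μ p) else 0) =
      if ν + Finsupp.single j 1 = μ then
        (if someVariable (ν + Finsupp.single j 1) = some j then
          coeff (ν + Finsupp.single j 1) p else 0) else 0 := by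
    by_cases hμ : someVariable μ = some j
    · have hj := apply_ne_zero_of_someVariable hμ
      have hle : Finsupp.single j 1 ≤ μ := by
        rw [Finsupp.single_le_iff]
        omega
      rw [if_pos hμ, coeff_monomial]
      by_cases he : μ - Finsupp.single j 1 = ν
      · have : ν + Finsupp.single j 1 = μ := by rw [← he, tsub_add_cancel_of_le hle]
        rw [if_pos he, if_pos this, this, if_pos hμ]
      · rw [if_neg he, if_neg]
        rintro rfl
        exact he (add_tsub_cancel_right _ _)
    · rw [if_neg hμ, coeff_zero]
      split_ifs with h1 h2
      · exact absurd (h1 ▸ h2) hμ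
      · rfl
      · rfl
  rw [variableQuotient, coeff_sum, Finset.sum_congr rfl fun μ _ => h μ, Finset.sum_ite_eq]
  split_ifs with h1 h2 h2
  · rfl
  · rfl
  · exact (notMem_support_iff.1 h1).symm
  · rfl

theorem variableQuotient_sum {κ : Type*} (s : Finset κ) (j : σ) (p : κ → MvPolynomial σ A) :
    variableQuotient j (∑ i ∈ s, p i) = ∑ i ∈ s, variableQuotient j (p i) := by
  classical
  ext ν
  simp only [coeff_sum, coeff_variableQuotient]
  split_ifs <;> simp

theorem variableQuotient_zero (j : σ) : variableQuotient j (0 : MvPolynomial σ A) = 0 := by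
  simp [variableQuotient]

theorem isHomogeneous_variableQuotient {t : ℕ} {p : MvPolynomial σ A}
    (hp : p.IsHomogeneous (t + 1)) (j : σ) : (variableQuotient j p).IsHomogeneous t := by
  classical
  intro ν hν
  rw [coeff_variableQuotient] at hν
  have := hp (d := ν + Finsupp.single j 1) (by
    intro h0
    rw [h0] at hν
    simp at hν)
  simpa [Finsupp.weight_apply, Finsupp.sum_add_index'] using this

theorem sum_X_mul_variableQuotient [Fintype σ] {p : MvPolynomial σ A} (hp : coeff 0 p = 0) :
    ∑ j, X j * variableQuotient j p = p := by
  classical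
  ext ν
  have h (j : σ) : coeff ν (X j * variableQuotient j p) =
      if someVariable ν = some j then coeff ν p else 0 := by
    rw [coeff_X_mul']
    split_ifs with h1 h2 h2
    · have hle : Finsupp.single j 1 ≤ ν := by
        rw [Finsupp.single_le_iff]
        have := Finsupp.mem_support_iff.1 h1
        omega
      rw [coeff_variableQuotient, tsub_add_cancel_of_le hle, if_pos h2]
    · have hle : Finsupp.single j 1 ≤ ν := by
        rw [Finsupp.single_le_iff]
        have := Finsupp.mem_support_iff.1 h1
        omega
      rw [coeff_variableQuotient, tsub_add_cancel_of_le hle, if_neg h2]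
    · exact absurd (Finsupp.mem_support_iff.2 (apply_ne_zero_of_someVariable h2)) h1
    · rfl
  rw [coeff_sum, Finset.sum_congr rfl fun j _ => h j]
  by_cases hν : ν = 0
  · simp [hν, hp]
  · obtain ⟨j, hj⟩ := exists_someVariable hν
    simp [hj]

theorem X_mul_divMonomial_variableQuotient {i j : σ} (hij : i ≠ j) (p : MvPolynomial σ A) :
    X i * (variableQuotient j (X i * p)).divMonomial (Finsupp.single i 1) =
      variableQuotient j (X i * p) := by
  classical
  ext ν
  rw [coeff_X_mul', coeff_divMonomial]
  split_ifs with h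
  · have hle : Finsupp.single i 1 ≤ ν := by
      rw [Finsupp.single_le_iff]
      have := Finsupp.mem_support_iff.1 h
      omega
    rw [add_tsub_cancel_of_le hle]
  · rw [coeff_variableQuotient, coeff_X_mul', if_neg (c := i ∈ _), ite_self]
    rw [Finsupp.mem_support_iff, not_not] at h ⊢
    simp [h, hij.symm]

/-- The linear syzygies of the variables are the Koszul syzygies. -/
theorem exists_koszul_of_sum_X_mul_eq_zero [Fintype σ] {t : ℕ} {f : σ → MvPolynomial σ A}
    (hf : ∀ i, (f i).IsHomogeneous (t + 1)) (h0 : ∑ i, X i * f i = 0) :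
    ∃ w : σ → σ → MvPolynomial σ A, (∀ i j, (w i j).IsHomogeneous t) ∧
      ∀ i, f i = ∑ j, (X j * w i j - X j * w j i) := by
  classical
  let D (j i : σ) : MvPolynomial σ A := variableQuotient j (X i * f i)
  have hXf (i : σ) : (X i * f i).IsHomogeneous (t + 1 + 1) := by
    rw [add_comm (t + 1)]
    exact (isHomogeneous_X A i).mul (hf i)
  have hD (i j : σ) : (D j i).IsHomogeneous (t + 1) := isHomogeneous_variableQuotient (hXf i) j
  let w (i j : σ) : MvPolynomial σ A :=
    if i = j then 0 else (D j i).divMonomial (Finsupp.single i 1)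
  have hw (i j : σ) : X i * w i j = if i = j then 0 else D j i := by
    simp only [w]
    split_ifs with h
    · simp
    · exact X_mul_divMonomial_variableQuotient h (f i)
  refine ⟨w, fun i j => ?_, fun i => ?_⟩
  · simp only [w]
    split_ifs
    · exact isHomogeneous_zero _ _ _
    · intro ν hν
      rw [coeff_divMonomial] at hν
      have := hD i j hν
      simp only [map_add, Finsupp.weight_single, Pi.one_apply, smul_eq_mul, mul_one] at this
      omega
  · have hsum : ∑ j, X j * D j i = X i * f i :=
      sum_X_mul_variableQuotient (by simp [coeff_X_mul'])
    have hDi : ∑ j, D i j = 0 := by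
      rw [← variableQuotient_sum, h0, variableQuotient_zero]
    have h1 : X i * f i = X i * ∑ j, X j * w i j + X i * D i i := by
      rw [← hsum, Finset.mul_sum, ← Finset.sum_erase_add _ (fun j => X j * D j i)
        (Finset.mem_univ i),
        ← Finset.sum_erase_add _ (fun j => X i * (X j * w i j)) (Finset.mem_univ i)]
      have : w i i = 0 := by simp [w]
      rw [this, mul_zero, mul_zero, add_zero]
      congr 1
      refine Finset.sum_congr rfl fun j hj => ?_
      rw [mul_left_comm, hw, if_neg (Finset.ne_of_mem_erase hj).symm]
    have h2 : D i i = - ∑ j, X j * w j i := by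
      rw [eq_neg_iff_add_eq_zero, ← hDi]
      simp only [hw]
      rw [← Finset.add_sum_erase _ (fun j => D i j) (Finset.mem_univ i),
        ← Finset.add_sum_erase _ (fun j => if j = i then 0 else D i j) (Finset.mem_univ i)]
      simp only [if_true, zero_add]
      congr 1
      exact Finset.sum_congr rfl fun j hj => if_neg (Finset.ne_of_mem_erase hj)
    rw [← mul_add] at h1
    have h3 : f i = ∑ j, X j * w i j + D i i := by
      ext ν
      have := congrArg (coeff (Finsupp.single i 1 + ν)) h1
      rwa [coeff_X_mul, coeff_X_mul] at this
    rw [Finset.sum_sub_distrib, sub_eq_add_neg, ← h2, ← h3]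

end PolynomialKoszul

section LocallyFree

theorem IsLocallyFreeOfRank.exists_equiv {A L : Type*} [CommRing A] [AddCommGroup L] [Module A L]
    {n : ℕ} (h : IsLocallyFreeOfRank A L n) (B : Type*) [CommRing B] [IsLocalRing B]
    [Algebra A B] : Nonempty (B ⊗[A] L ≃ₗ[B] (Fin n → B)) := by
  obtain ⟨f, hf, ⟨e⟩⟩ := h ⟨(IsLocalRing.maximalIdeal B).comap (algebraMap A B), inferInstance⟩
  have hu : IsUnit (algebraMap A B f) := by simpa using hf
  let Af := Localization (Submonoid.powers f)
  let _ : Algebra Af B := (IsLocalization.Away.lift (S := Af) f hu).toAlgebra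
  have : IsScalarTower A Af B := IsScalarTower.of_algebraMap_eq fun a => by
    rw [RingHom.algebraMap_toAlgebra, IsLocalization.Away.lift_eq]
  let e' : Af ⊗[A] L ≃ₗ[Af] (Fin n → Af) :=
    (LocalizedModule.equivTensorProduct (Submonoid.powers f) L).symm.trans e
  exact ⟨(TensorProduct.AlgebraTensorModule.cancelBaseChange A Af B B L).symm.trans
    ((e'.baseChange Af B _ _).trans (TensorProduct.piScalarRight Af B B (Fin n)))⟩

end LocallyFree

section QuotPieces

open MvPolynomial

variable {A : Type*} [CommRing A] {r p : ℕ}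

theorem smul_mem_freePiece {t u : ℕ} {f : PolyRing A r} (hf : f.IsHomogeneous t)
    {x : FreeMod A r p} (hx : x ∈ freePiece A r p u) : f • x ∈ freePiece A r p (t + u) :=
  mem_freePiece.2 fun i => hf.mul (mem_freePiece.1 hx i)

theorem X_smul_mem_freePiece {t : ℕ} (i : Fin (r + 1)) {x : FreeMod A r p}
    (hx : x ∈ freePiece A r p t) : (X i : PolyRing A r) • x ∈ freePiece A r p (t + 1) := by
  have := smul_mem_freePiece (isHomogeneous_X A i) hx
  rwa [add_comm 1 t] at this

variable (N : Submodule (PolyRing A r) (FreeMod A r p))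

/-- Multiplication by a variable on the graded pieces of `M / N`. -/
noncomputable def quotPieceX (t : ℕ) (i : Fin (r + 1)) :
    quotPiece N t →ₗ[A] quotPiece N (t + 1) :=
  ((LinearMap.lsmul (PolyRing A r) (FreeMod A r p ⧸ N) (X i)).restrictScalars A).restrict (by
    rintro _ ⟨x, hx, rfl⟩
    exact ⟨(X i : PolyRing A r) • x, X_smul_mem_freePiece i hx, N.mkQ.map_smul _ _⟩)

theorem quotPieceX_coe (t : ℕ) (i : Fin (r + 1)) (q : quotPiece N t) :
    (quotPieceX N t i q : FreeMod A r p ⧸ N) = (X i : PolyRing A r) • (q : FreeMod A r p ⧸ N) :=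
  rfl

theorem exists_eq_sum_X_smul {t : ℕ} {x : FreeMod A r p} (hx : x ∈ freePiece A r p (t + 1)) :
    ∃ y : Fin (r + 1) → FreeMod A r p, (∀ i, y i ∈ freePiece A r p t) ∧
      ∑ i, (X i : PolyRing A r) • y i = x := by
  refine ⟨fun i a => variableQuotient i (x a), fun i => mem_freePiece.2 fun a =>
    isHomogeneous_variableQuotient (mem_freePiece.1 hx a) i, funext fun a => ?_⟩
  have h0 : coeff 0 (x a) = 0 := (mem_freePiece.1 hx a).coeff_eq_zero (by simp)
  simpa [Finset.sum_apply] using sum_X_mul_variableQuotient h0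

theorem isTower_quotPieceX : IsTower (quotPieceX N) where
  comm t i j q := Subtype.ext (by
    simp only [quotPieceX_coe, ← mul_smul, mul_comm])
  span := by
    rintro t ⟨_, x, hx, rfl⟩
    obtain ⟨y, hy, rfl⟩ := exists_eq_sum_X_smul hx
    refine ⟨fun i => ⟨N.mkQ (y i), y i, hy i, rfl⟩, Subtype.ext ?_⟩
    simp [quotPieceX_coe]

instance finite_quotPiece_zero : Module.Finite A (quotPiece N 0) := by
  let f : (Fin p → A) →ₗ[A] FreeMod A r p :=
    LinearMap.pi fun i => (Algebra.linearMap A (PolyRing A r)) ∘ₗ LinearMap.proj i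
  have hf (v) : f v ∈ freePiece A r p 0 := mem_freePiece.2 fun i => isHomogeneous_C _ _
  refine Module.Finite.of_surjective (((N.mkQ.restrictScalars A) ∘ₗ f).codRestrict (quotPiece N 0)
    fun v => ⟨f v, hf v, rfl⟩) ?_
  rintro ⟨_, x, hx, rfl⟩
  refine ⟨fun i => coeff 0 (x i), Subtype.ext ?_⟩
  change N.mkQ (f _) = N.mkQ x
  congr 1
  funext i
  have := (totalDegree_eq_zero_iff_eq_C (p := x i)).1
    (Nat.le_zero.1 (mem_freePiece.1 hx i).totalDegree_le)
  rw [this]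
  simp [f, algebraMap_eq]

variable {N}

theorem GeneratedInDegreesLE.exists_freeComponent_eq {d : ℕ} (hgen : GeneratedInDegreesLE N d)
    {t : ℕ} (ht : d ≤ t) {x : FreeMod A r p} (hx : x ∈ N) :
    ∃ y : Fin (r + 1) → FreeMod A r p, (∀ i, y i ∈ N ∧ y i ∈ freePiece A r p t) ∧
      ∑ i, (X i : PolyRing A r) • y i = freeComponent A r p (t + 1) x := by
  rw [hgen] at hx
  induction hx using Submodule.closure_induction with
  | zero => exact ⟨0, fun i => ⟨zero_mem _, zero_mem _⟩, by simp⟩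
  | add x x' _ _ hx hx' =>
    obtain ⟨y, hy, h⟩ := hx
    obtain ⟨y', hy', h'⟩ := hx'
    exact ⟨y + y', fun i => ⟨add_mem (hy i).1 (hy' i).1, add_mem (hy i).2 (hy' i).2⟩, by
      simp [Finset.sum_add_distrib, h, h']⟩
  | smul_mem f x hx =>
    obtain ⟨hxN, u, hu, hxu⟩ := hx
    obtain ⟨v, rfl⟩ : ∃ v, t = v + u := ⟨t - u, by omega⟩
    refine ⟨fun i => variableQuotient i (homogeneousComponent (v + 1) f) • x, fun i =>
      ⟨N.smul_mem _ hxN, smul_mem_freePiece (isHomogeneous_variableQuotient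
        (homogeneousComponent_isHomogeneous _ _) i) hxu⟩, ?_⟩
    simp only [← mul_smul, ← Finset.sum_smul]
    rw [sum_X_mul_variableQuotient ((homogeneousComponent_isHomogeneous _ _).coeff_eq_zero
      (by simp))]
    conv_rhs => rw [← sum_homogeneousComponent f, Finset.sum_smul, map_sum]
    have h (i : ℕ) : freeComponent A r p (v + u + 1) (homogeneousComponent i f • x) =
        if i = v + 1 then homogeneousComponent (v + 1) f • x else 0 := by
      rw [freeComponent_of_mem
        (smul_mem_freePiece (homogeneousComponent_isHomogeneous i f) hxu)]
      by_cases hi : i = v + 1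
      · rw [if_pos (by omega), if_pos hi, hi]
      · rw [if_neg (by omega), if_neg hi]
    rw [Finset.sum_congr rfl fun i _ => h i, Finset.sum_ite_eq']
    split_ifs with hv
    · rfl
    · rw [homogeneousComponent_eq_zero _ _ (by simpa using hv), zero_smul]

theorem GeneratedInDegreesLE.isKoszulExactAt {d : ℕ} (hgen : GeneratedInDegreesLE N d)
    {t : ℕ} (ht : d ≤ t + 1) : IsKoszulExactAt (quotPieceX N) t := by
  intro q hq
  choose m hm hmq using fun i => (q i).2
  have hmN : ∑ i, (X i : PolyRing A r) • m i ∈ N := by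
    have := congrArg Subtype.val hq
    simp only [AddSubmonoidClass.coe_finsetSum, quotPieceX_coe, ← hmq, ZeroMemClass.coe_zero]
      at this
    rw [← Submodule.Quotient.mk_eq_zero, ← Submodule.mkQ_apply, map_sum, ← this]
    rfl
  have hmd : ∑ i, (X i : PolyRing A r) • m i ∈ freePiece A r p (t + 1 + 1) :=
    Submodule.sum_mem _ fun i _ => X_smul_mem_freePiece i (hm i)
  obtain ⟨y, hy, hys⟩ := hgen.exists_freeComponent_eq ht hmN
  rw [freeComponent_of_mem hmd, if_pos rfl] at hys
  have hz : ∑ i, (X i : PolyRing A r) • (m i - y i) = 0 := by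
    simp only [smul_sub, Finset.sum_sub_distrib, hys, sub_self]
  have hzd (i) : m i - y i ∈ freePiece A r p (t + 1) := sub_mem (hm i) (hy i).2
  choose w hw hwz using fun a : Fin p => exists_koszul_of_sum_X_mul_eq_zero
    (f := fun i => (m i - y i) a) (fun i => mem_freePiece.1 (hzd i) a)
    (by simpa [Finset.sum_apply] using congrFun hz a)
  refine ⟨fun i j => ⟨N.mkQ fun a => w a i j, _, mem_freePiece.2 fun a => hw a i j, rfl⟩,
    fun i => Subtype.ext ?_⟩
  have hmy : m i - y i = ∑ j, ((X j : PolyRing A r) • (fun a => w a i j : FreeMod A r p) -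
      (X j : PolyRing A r) • (fun a => w a j i : FreeMod A r p)) := by
    funext a
    simpa [Finset.sum_apply] using hwz a i
  have hqm : (q i : FreeMod A r p ⧸ N) = N.mkQ (m i - y i) := by
    have hy0 : N.mkQ (y i) = 0 := (Submodule.Quotient.mk_eq_zero N).2 (hy i).1
    rw [map_sub, hy0, sub_zero, ← hmq]
    rfl
  rw [hqm, hmy, map_sum]
  simp only [map_sub, map_smul, AddSubmonoidClass.coe_finsetSum, AddSubgroupClass.coe_sub,
    quotPieceX_coe]

end QuotPieces

universe u

/-- Two Fitting ideals are comparable if freeness of rank `n` of one module after a base change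
implies that of the other one. -/
theorem fittingIdeal_le_of_forall_baseChange {A L L' : Type u} [CommRing A] [AddCommGroup L]
    [Module A L] [Module.Finite A L] [AddCommGroup L'] [Module A L'] {n : ℕ}
    (h : ∀ (B : Type u) [CommRing B] [IsLocalRing B] [Algebra A B]
      [Infinite (IsLocalRing.ResidueField B)],
      (∃ σ : (Fin n → B) →ₗ[B] B ⊗[A] L, Function.Surjective σ) ∧
        (Nonempty (B ⊗[A] L ≃ₗ[B] (Fin n → B)) → Nonempty (B ⊗[A] L' ≃ₗ[B] (Fin n → B)))) :
    fittingIdeal A L' ((n : ℤ) - 1) ≤ fittingIdeal A L ((n : ℤ) - 1) := by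
  intro x hx
  by_contra hx'
  obtain ⟨B, _, _, _, _, hI, hxB⟩ := exists_local_algebra_of_notMem _ hx'
  obtain ⟨⟨σ, hσ⟩, hfree⟩ := h B
  obtain ⟨e⟩ := hfree (exists_equiv_of_fittingIdeal_map_eq_bot hI σ hσ)
  exact hxB (algebraMap_eq_zero_of_mem_fittingIdeal e hx)

theorem mainTheorem3 {A : Type*} [CommRing A] (r p d n : ℕ)
    (N : Submodule (PolyRing A r) (FreeMod A r p))
    (hN : N.IsHomogeneous (freePiece A r p))
    (hgen : GeneratedInDegreesLE N d)
    (hP : ∀ 𝔭 : PrimeSpectrum A,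
      IsHilbertPolynomial (fiberHilbertFunction N 𝔭) (Polynomial.C (n : ℚ)))
    (hfree : IsLocallyFreeOfRank A (quotPiece N d) n)
    (hnd : n ≤ d) :
    ∀ s : ℕ, 0 < s →
      fittingIdeal A (quotPiece N (d + s)) ((n : ℤ) - 1) =
        fittingIdeal A (quotPiece N (d + 1)) ((n : ℤ) - 1) := by

  intro s hs
  obtain ⟨s, rfl⟩ := Nat.exists_eq_succ_of_ne_zero hs.ne'
  have hX := isTower_quotPieceX N
  have hfin := hX.finite
  have hlocal (B : Type _) [CommRing B] [IsLocalRing B] [Algebra A B]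
      [Infinite (IsLocalRing.ResidueField B)] :
      (∀ u, ∃ σ : (Fin n → B) →ₗ[B] B ⊗[A] quotPiece N (d + u), Function.Surjective σ) ∧
        (Nonempty (B ⊗[A] quotPiece N (d + (s + 1)) ≃ₗ[B] (Fin n → B)) ↔
          Nonempty (B ⊗[A] quotPiece N (d + 1) ≃ₗ[B] (Fin n → B))) := by
    obtain ⟨e⟩ := hfree.exists_equiv B
    exact ⟨(hX.baseChange B).exists_surjective_fin e hnd, (hX.baseChange B).nonempty_equiv_iff
      (fun t ht => (hgen.isKoszulExactAt ht).baseChange B hX) e hnd s⟩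
  apply le_antisymm
  · refine fittingIdeal_le_of_forall_baseChange fun B _ _ _ _ => ?_
    exact ⟨(hlocal B).1 1, (hlocal B).2.2⟩
  · refine fittingIdeal_le_of_forall_baseChange fun B _ _ _ _ => ?_
    exact ⟨(hlocal B).1 (s + 1), (hlocal B).2.1⟩
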